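/- Let $\mathbb X,\mathbb Y$ be Hilbert spaces over the same field ($\mathbb R$ or $\mathbb C$), let $\Omega\subseteq\mathbb X$ be open, and let $F:\Omega\to\mathbb Y$ be continuously differentiable such that $F'(x)$ has closed range for every $x\in\Omega$. Let $J:\mathbb X\to\mathbb R\cup\{+\infty\}$ be proper, convex, and lower semicontinuous at every point of $\Omega$ (a functional given only on $\Omega$ is extended by $+\infty$). For a bounded operator $A$ with closed range let $A^\dagger$ be its Moore–Penrose inverse, i.e. the unique bounded operator with $AA^\dagger A=A$, $A^\dagger AA^\dagger=A^\dagger$, $(AA^\dagger)^*=AA^\dagger$, $(A^\dagger A)^*=A^\dagger A$. Let $\partial J(x)=\{u:\ J(y)\ge J(x)+\operatorname{Re}\langle u,y-x\rangle\ \forall y\in\mathbb X\}$. For a positive selfadjoint bounded operator $H$ on $\mathbb X$ that is bounded from below, let $\|x\|_H^2=\langle x,Hx\rangle$ and $\operatorname{prox}_J^H(z)=\operatorname{argmin}_{x\in\mathbb X}\{J(x)+\tfrac12\|x-z\|_H^2\}$. Put $H(x)=F'(x)^*F'(x)$. **Theorem.** Let $x_*\in\Omega$, $R>0$, and $$c=\|F(x_*)\|,\quad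 \beta=\|F'(x_*)^\dagger\|,\quad \kappa=\beta\|F'(x_*)\|,\quad \delta=\sup\{t\in[0,R):B(x_*,t)\subset\Omega\},$$ where $B(a,t)$ is the open ball. Suppose that $-F'(x_*)^*F(x_*)\in\partial J(x_*)$, that $F'(x_*)$ is injective, and that there is a continuously differentiable $f:[0,R)\to\mathbb R$ with $$\beta\|F'(x)-F'(x_*+\tau(x-x_*))\|\le f'(\sigma(x))-f'(\tau\sigma(x)),\qquad x\in B(x_*,\delta),\ \tau\in[0,1],\quad \sigma(x)=\|x-x_*\|,$$ such that * (h1) $f(0)=0$ and $f'(0)=-1$; * (h2) $f'$ is convex and strictly increasing; * (h3) $[(1+\sqrt2)\kappa+1]\,c\,\beta\, D^+f'(0)<1$, where $D^+f'(0)=\lim_{u\to0+}\frac{f'(u)-f'(0)}{u}$. Let $\nu=\sup\{t\in[0,R):f'(t)<0\}$, $$\rho=\sup\left\{t\in(0,\nu):\frac{[f'(t)+1+\kappa]\,[tf'(t)-f(t)+c\beta(1+\sqrt2)(f'(t)+1)]+c\beta[f'(t)+1]}{t[f'(t)]^2}<1\right\},\qquad r=\min\{\rho,\delta\}.$$ Then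 $\delta,\nu,\rho,r$ are positive, and for every $x_0\in B(x_*,r)\setminus\{x_*\}$ the proximal Gauss–Newton sequence $$x_{k+1}=\operatorname{prox}_J^{H(x_k)}\big(x_k-F'(x_k)^\dagger F(x_k)\big),\qquad k=0,1,\dots,$$ is well defined (for every $k$: $x_k\in\Omega$, $F'(x_k)$ is injective with a Moore–Penrose inverse, $H(x_k)$ is positive selfadjoint, bounded from below and invertible, and the minimizer defining $x_{k+1}$ exists and is unique), is contained in $B(x_*,r)$, converges to $x_*$, and satisfies for all $k\ge 0$, with $\sigma_0=\|x_0-x_*\|$, $$\begin{aligned}\|x_{k+1}-x_*\|\le{}&\frac{[f'(\sigma_0)+1+\kappa]\,[f'(\sigma_0)\sigma_0-f(\sigma_0)]}{[\sigma_0f'(\sigma_0)]^2}\|x_k-x_*\|^2+\frac{(1+\sqrt2)\beta c\,[f'(\sigma_0)+1]^2}{[\sigma_0f'(\sigma_0)]^2}\|x_k-x_*\|^2\\&+\frac{c\beta\,[(1+\sqrt2)\kappa+1]\,[f'(\sigma_0)+1]}{\sigma_0[f'(\sigma_0)]^2}\|x_k-x_*\|.\end{aligned}$$ -/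

import Mathlib

open Set Filter Topology

noncomputable section

namespace ProxGN

variable {𝕜 : Type*} [RCLike 𝕜]
  {X : Type*} [NormedAddCommGroup X] [InnerProductSpace 𝕜 X] [CompleteSpace X]
  {Y : Type*} [NormedAddCommGroup Y] [InnerProductSpace 𝕜 Y] [CompleteSpace Y]

/-- The four Penrose equations: `B` is the Moore-Penrose inverse of `A`. -/
structure IsMoorePenroseInverse (A : X →L[𝕜] Y) (B : Y →L[𝕜] X) : Prop where
  left : A ∘L B ∘L A = A
  right : B ∘L A ∘L B = B
  selfAdjoint_left : ContinuousLinearMap.adjoint (A ∘L B) = A ∘L B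
  selfAdjoint_right : ContinuousLinearMap.adjoint (B ∘L A) = B ∘L A

theorem IsMoorePenroseInverse.unique {A : X →L[𝕜] Y} {B C : Y →L[𝕜] X}
    (hB : IsMoorePenroseInverse A B) (hC : IsMoorePenroseInverse A C) : B = C := by
  have h1 : A ∘L B = A ∘L C := by
    have e : (A ∘L C) ∘L (A ∘L B) = A ∘L B := by
      calc (A ∘L C) ∘L (A ∘L B) = (A ∘L C ∘L A) ∘L B := rfl
        _ = A ∘L B := by rw [hC.left]
    have e' := congrArg ContinuousLinearMap.adjoint e
    rw [ContinuousLinearMap.adjoint_comp, hB.selfAdjoint_left, hC.selfAdjoint_left] at e'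
    rw [← e']
    calc (A ∘L B) ∘L (A ∘L C) = (A ∘L B ∘L A) ∘L C := rfl
      _ = A ∘L C := by rw [hB.left]
  have h2 : B ∘L A = C ∘L A := by
    have e : (B ∘L A) ∘L (C ∘L A) = B ∘L A := by
      calc (B ∘L A) ∘L (C ∘L A) = B ∘L (A ∘L C ∘L A) := rfl
        _ = B ∘L A := by rw [hC.left]
    have e' := congrArg ContinuousLinearMap.adjoint e
    rw [ContinuousLinearMap.adjoint_comp, hB.selfAdjoint_right, hC.selfAdjoint_right] at e'
    rw [← e']
    calc (C ∘L A) ∘L (B ∘L A) = C ∘L (A ∘L B ∘L A) := rfl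
      _ = C ∘L A := by rw [hB.left]
  calc B = B ∘L (A ∘L B) := hB.right.symm
    _ = B ∘L (A ∘L C) := by rw [h1]
    _ = (B ∘L A) ∘L C := rfl
    _ = (C ∘L A) ∘L C := by rw [h2]
    _ = C := hC.right

open Classical in
/-- The Moore-Penrose inverse `A†` of a bounded operator; it exists exactly when the range of `A`
is closed (the value is `0` otherwise). -/
def pinv (A : X →L[𝕜] Y) : Y →L[𝕜] X :=
  if h : ∃ B : Y →L[𝕜] X, IsMoorePenroseInverse A B then h.choose else 0

/-- Proper functional with values in `ℝ ∪ {+∞}`. -/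
def IsProper (J : X → EReal) : Prop :=
  (∀ x, J x ≠ ⊥) ∧ ∃ x, J x ≠ ⊤

variable (𝕜) in
/-- Convexity of a functional with values in `ℝ ∪ {+∞}`. -/
def IsConvex (J : X → EReal) : Prop :=
  ∀ x y : X, ∀ a b : ℝ, 0 ≤ a → 0 ≤ b → a + b = 1 →
    J ((a : 𝕜) • x + (b : 𝕜) • y) ≤ (a : EReal) * J x + (b : EReal) * J y

variable (𝕜) in
/-- The subdifferential `∂J(x)` with respect to the real scalar product `Re ⟪·, ·⟫`. -/
def subdifferential (J : X → EReal) (x : X) : Set X :=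
  {u | ∀ y : X, J x + ((RCLike.re (inner 𝕜 u (y - x)) : ℝ) : EReal) ≤ J y}

/-- The squared norm `‖x‖_H ^ 2 = ⟪x, H x⟫` (a real number when `H` is selfadjoint). -/
def normSqH (H : X →L[𝕜] X) (x : X) : ℝ :=
  RCLike.re (inner 𝕜 x (H x))

/-- `p` minimizes `x ↦ J x + ½ ‖x - z‖_H ^ 2` over `X`. -/
def IsProxPoint (J : X → EReal) (H : X →L[𝕜] X) (z p : X) : Prop :=
  ∀ x : X, J p + ((1 / 2 * normSqH H (p - z) : ℝ) : EReal)
    ≤ J x + ((1 / 2 * normSqH H (x - z) : ℝ) : EReal)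

open Classical in
/-- The proximity operator `prox_J^H z = argmin_x { J x + ½ ‖x - z‖_H ^ 2 }`
(the value is `0` if there is no minimizer). -/
def prox (J : X → EReal) (H : X →L[𝕜] X) (z : X) : X :=
  if h : ∃ p : X, IsProxPoint J H z p then h.choose else 0

variable (𝕜) in
/-- `H(x) = F'(x)^* F'(x)`. -/
def gramOp (F : X → Y) (x : X) : X →L[𝕜] X :=
  ContinuousLinearMap.adjoint (fderiv 𝕜 F x) ∘L fderiv 𝕜 F x

variable (𝕜) in
/-- The Gauss-Newton point `x - F'(x)† F(x)`. -/
def gnPoint (F : X → Y) (x : X) : X :=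
  x - pinv (fderiv 𝕜 F x) (F x)

variable (𝕜) in
/-- The proximal Gauss-Newton sequence
`x_{k+1} = prox_J^{H(x_k)} (x_k - F'(x_k)† F(x_k))` started at `x₀`. -/
def proxGNSeq (F : X → Y) (J : X → EReal) (x₀ : X) : ℕ → X
  | 0 => x₀
  | k + 1 => prox J (gramOp 𝕜 F (proxGNSeq F J x₀ k)) (gnPoint 𝕜 F (proxGNSeq F J x₀ k))

variable (𝕜) in
/-- One step of the iteration is well defined at `x`: `x` lies in the domain `Ω` of `F`, `F'(x)` is
injective and has a Moore-Penrose inverse, `H(x)` is positive selfadjoint, bounded from below and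
invertible, and the functional that defines `prox_J^{H(x)} (x - F'(x)† F(x))` has exactly one
minimizer. -/
structure StepWellDefined (Ω : Set X) (F : X → Y) (J : X → EReal) (x : X) : Prop where
  mem : x ∈ Ω
  injective : Function.Injective (fderiv 𝕜 F x)
  pinv_exists : ∃ B : Y →L[𝕜] X, IsMoorePenroseInverse (fderiv 𝕜 F x) B
  positive : (gramOp 𝕜 F x).IsPositive
  bounded_below : ∃ m : ℝ, 0 < m ∧ ∀ v : X, m * ‖v‖ ^ 2 ≤ normSqH (gramOp 𝕜 F x) v
  invertible : IsUnit (gramOp 𝕜 F x)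
  prox_existsUnique : ∃! p : X, IsProxPoint J (gramOp 𝕜 F x) (gnPoint 𝕜 F x) p

end ProxGN

end

/-! Write `A = F'(x)`, `B = F'(xs)`, let `z` be the Gauss-Newton point at `x`, and let `p` be the
next iterate. Strong minimality of `p`, tested at `xs` and combined with the subgradient `u = -B*
F(xs)` at `xs`, gives `Re⟪u, p - xs⟫ + Re⟪A(p - z), A(p - xs)⟫ ≤ 0`. The normal equation `A* A A† =
A*` turns this into `‖A(p - xs)‖² ≤ W ‖A(p - xs)‖ + c ‖A - B‖ ‖p - xs‖`, where `W` is the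
linearization error, so a lower bound `m` for `A` yields `‖p - xs‖ ≤ W/m + c ‖A - B‖/m²`
(`norm_sub_le_of_variational_inequality`). The majorant function controls `W`, `‖A - B‖` and `m`,
which gives `stepBound`. The asserted estimate is weaker: its terms with `κ` and `√2` are slack.

`J` is lower semicontinuous only on `Ω`, so existence of `p` needs care. A minimizing sequence is
Cauchy by strong convexity, and its limit satisfies the variational inequality before any
semicontinuity is used. The resulting distance bound puts the limit in `Ω`, where semicontinuity
makes it a minimizer (`exists_strong_minimizer`).

`stepBound` separates the reference radius `s` from the distance `σ`. A radius `t` beyond `‖x₀ -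
xs‖` with quotient below 1 gives a contraction, and `s = ‖x₀ - xs‖` gives the stated estimate. -/

namespace ProxGN

/-! ### Moore-Penrose inverses and minimization without global semicontinuity -/

section
variable {𝕜 : Type*} [RCLike 𝕜]
  {X : Type*} [NormedAddCommGroup X] [InnerProductSpace 𝕜 X] [CompleteSpace X]
  {Y : Type*} [NormedAddCommGroup Y] [InnerProductSpace 𝕜 Y] [CompleteSpace Y]

theorem pinv_spec {A : X →L[𝕜] Y} (h : ∃ B : Y →L[𝕜] X, IsMoorePenroseInverse A B) :
    IsMoorePenroseInverse A (pinv A) := by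
  rw [pinv, dif_pos h]
  exact h.choose_spec

omit [CompleteSpace X] in
theorem prox_spec {J : X → EReal} {H : X →L[𝕜] X} {z : X} (h : ∃ p, IsProxPoint J H z p) :
    IsProxPoint J H z (prox J H z) := by
  rw [prox, dif_pos h]
  exact h.choose_spec

theorem normSqH_adjoint_comp_self (A : X →L[𝕜] Y) (v : X) :
    normSqH (ContinuousLinearMap.adjoint A ∘L A) v = ‖A v‖ ^ 2 := by
  rw [normSqH, ContinuousLinearMap.comp_apply, ContinuousLinearMap.adjoint_inner_right,
    inner_self_eq_norm_sq]

/-- Lax-Milgram: `⟪A* A v, v⟫ = ‖A v‖²` is coercive with constant `m²`. -/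
theorem isUnit_adjoint_comp_self {A : X →L[𝕜] Y} {m : ℝ} (hm : 0 < m)
    (h : ∀ v, m * ‖v‖ ≤ ‖A v‖) : IsUnit (ContinuousLinearMap.adjoint A ∘L A) := by
  refine ContinuousLinearMap.isUnit_of_forall_le_norm_inner_map _
    (c := ⟨m ^ 2, sq_nonneg m⟩) (by exact pow_pos hm 2) fun v => ?_
  rw [ContinuousLinearMap.comp_apply, ContinuousLinearMap.adjoint_inner_left,
    inner_self_eq_norm_sq_to_K, norm_pow, RCLike.norm_ofReal, abs_norm]
  calc ‖v‖ ^ 2 * m ^ 2 = (m * ‖v‖) ^ 2 := by ring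
    _ ≤ ‖A v‖ ^ 2 := by gcongr; exact h v

/-- The inverse is `(A* A)⁻¹ A*`, a left inverse of `A`; selfadjointness of `(A* A)⁻¹` gives the
third Penrose equation. -/
theorem exists_isMoorePenroseInverse {A : X →L[𝕜] Y} {m : ℝ} (hm : 0 < m)
    (h : ∀ v, m * ‖v‖ ≤ ‖A v‖) : ∃ B : Y →L[𝕜] X, IsMoorePenroseInverse A B := by
  obtain ⟨G, hG⟩ := isUnit_adjoint_comp_self hm h
  set T := ContinuousLinearMap.adjoint A
  set K : X →L[𝕜] X := ↑G⁻¹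
  have e1 : K ∘L (T ∘L A) = ContinuousLinearMap.id 𝕜 X := by
    rw [← hG]; exact G.inv_mul
  have e2 : (T ∘L A) ∘L K = ContinuousLinearMap.id 𝕜 X := by
    rw [← hG]; exact G.mul_inv
  have hK : ContinuousLinearMap.adjoint K = K := by
    have h1 := congrArg ContinuousLinearMap.adjoint e2
    rw [ContinuousLinearMap.adjoint_comp, ContinuousLinearMap.adjoint_comp,
      ContinuousLinearMap.adjoint_adjoint, ContinuousLinearMap.adjoint_id] at h1
    calc ContinuousLinearMap.adjoint K
        = ContinuousLinearMap.adjoint K ∘L ((T ∘L A) ∘L K) := by rw [e2]; rfl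
      _ = (ContinuousLinearMap.adjoint K ∘L (T ∘L A)) ∘L K := rfl
      _ = K := by rw [h1]; rfl
  have e3 : (K ∘L T) ∘L A = ContinuousLinearMap.id 𝕜 X := e1
  refine ⟨K ∘L T, ?_, ?_, ?_, ?_⟩
  · rw [e3]; rfl
  · rw [← ContinuousLinearMap.comp_assoc, e3]; rfl
  · rw [ContinuousLinearMap.adjoint_comp, ContinuousLinearMap.adjoint_comp, hK,
      ContinuousLinearMap.adjoint_adjoint]; rfl
  · rw [e3, ContinuousLinearMap.adjoint_id]

theorem IsMoorePenroseInverse.adjoint_apply {A : X →L[𝕜] Y} {B : Y →L[𝕜] X}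
    (h : IsMoorePenroseInverse A B) (y : Y) :
    ContinuousLinearMap.adjoint A (A (B y)) = ContinuousLinearMap.adjoint A y := by
  have e : ContinuousLinearMap.adjoint A ∘L (A ∘L B) = ContinuousLinearMap.adjoint A := by
    rw [← h.selfAdjoint_left, ← ContinuousLinearMap.adjoint_comp]
    exact congrArg _ h.left
  exact congrArg (fun T => T y) e

theorem IsMoorePenroseInverse.leftInverse {A : X →L[𝕜] Y} {B : Y →L[𝕜] X}
    (h : IsMoorePenroseInverse A B) (hA : Function.Injective A) (v : X) : B (A v) = v :=
  hA (congrArg (fun T => T v) h.left)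

theorem exists_bound_of_injective_of_isClosed_range {A : X →L[𝕜] Y}
    (hA : Function.Injective A) (hc : IsClosed (Set.range A)) :
    ∃ m : ℝ, 0 < m ∧ ∀ v, m * ‖v‖ ≤ ‖A v‖ := by
  obtain ⟨K, h⟩ := A.antilipschitz_of_injective_of_isClosed_range hA hc
  refine ⟨((K : ℝ) + 1)⁻¹, by positivity, fun v => ?_⟩
  have := h.le_mul_dist v 0
  simp only [dist_zero_right, map_zero] at this
  rw [inv_mul_le_iff₀ (by positivity)]
  exact this.trans (by gcongr; simp)

omit [CompleteSpace X] in
theorem norm_sq_convex_combination (v w : X) {a b : ℝ} (hab : a + b = 1) :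
    ‖(a : 𝕜) • v + (b : 𝕜) • w‖ ^ 2 = a * ‖v‖ ^ 2 + b * ‖w‖ ^ 2 - a * b * ‖v - w‖ ^ 2 := by
  rw [norm_add_sq (𝕜 := 𝕜), norm_sub_sq (𝕜 := 𝕜), norm_smul, norm_smul, inner_smul_left,
    inner_smul_right, RCLike.conj_ofReal, RCLike.re_ofReal_mul, RCLike.re_ofReal_mul,
    RCLike.norm_ofReal, RCLike.norm_ofReal, mul_pow, mul_pow, sq_abs, sq_abs]
  obtain rfl : b = 1 - a := by linarith
  ring

omit [CompleteSpace Y] in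
/-- Existence of a strong minimizer of `j + ½ ‖A (· - z)‖ ^ 2` on `D`, where lower semicontinuity
of `j` is only needed at points that satisfy the variational inequality at `xs`. -/
theorem exists_strong_minimizer {D : Set X} {j : X → ℝ}
    (hj : ∀ x ∈ D, ∀ y ∈ D, ∀ a b : ℝ, 0 ≤ a → 0 ≤ b → a + b = 1 →
      (a : 𝕜) • x + (b : 𝕜) • y ∈ D ∧ j ((a : 𝕜) • x + (b : 𝕜) • y) ≤ a * j x + b * j y)
    {A : X →L[𝕜] Y} {m : ℝ} (hm : 0 < m) (hA : ∀ v, m * ‖v‖ ≤ ‖A v‖) {xs u z : X} (hxs : xs ∈ D)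
    (hu : ∀ y ∈ D, j xs + RCLike.re (inner 𝕜 u (y - xs)) ≤ j y)
    (hlsc : ∀ p : X, RCLike.re (inner 𝕜 u (p - xs)) +
      RCLike.re (inner 𝕜 (A (p - z)) (A (p - xs))) ≤ 0 → ∀ (x : ℕ → X) (l : ℝ), (∀ n, x n ∈ D) →
      Tendsto x atTop (𝓝 p) → Tendsto (fun n => j (x n)) atTop (𝓝 l) → p ∈ D ∧ j p ≤ l) :
    ∃ p ∈ D, RCLike.re (inner 𝕜 u (p - xs)) +
        RCLike.re (inner 𝕜 (A (p - z)) (A (p - xs))) ≤ 0 ∧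
      ∀ y ∈ D, j p + 1 / 2 * ‖A (p - z)‖ ^ 2 + 1 / 2 * ‖A (p - y)‖ ^ 2
        ≤ j y + 1 / 2 * ‖A (y - z)‖ ^ 2 := by
  set ψ : X → ℝ := fun x => j x + 1 / 2 * ‖A (x - z)‖ ^ 2 with hψ
  have hconv : ∀ x ∈ D, ∀ y ∈ D, ∀ a b : ℝ, 0 ≤ a → 0 ≤ b → a + b = 1 →
      (a : 𝕜) • x + (b : 𝕜) • y ∈ D ∧ ψ ((a : 𝕜) • x + (b : 𝕜) • y)
        ≤ a * ψ x + b * ψ y - 1 / 2 * (a * b * ‖A (x - y)‖ ^ 2) := by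
    intro x hx y hy a b ha hb hab
    obtain ⟨h1, h2⟩ := hj x hx y hy a b ha hb hab
    refine ⟨h1, ?_⟩
    have e : (a : 𝕜) • x + (b : 𝕜) • y - z = (a : 𝕜) • (x - z) + (b : 𝕜) • (y - z) := by
      have : z = ((a + b : ℝ) : 𝕜) • z := by rw [hab]; simp
      nth_rewrite 1 [this]
      rw [RCLike.ofReal_add]
      module
    have e2 : A (x - y) = A (x - z) - A (y - z) := by rw [← map_sub, sub_sub_sub_cancel_right]
    simp only [hψ]
    rw [e, map_add, map_smul, map_smul, norm_sq_convex_combination _ _ hab, e2]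
    linarith
  have hbdd : BddBelow (ψ '' D) := by
    -- The subgradient bounds `j` below by an affine function; completing the square in `m * ‖x -
    -- z‖` produces the last term.
    refine ⟨j xs - ‖u‖ * ‖z - xs‖ - ‖u‖ ^ 2 / (2 * m ^ 2), ?_⟩
    rintro _ ⟨x, hx, rfl⟩
    have h1 := hu x hx
    have h2 : -(‖u‖ * ‖x - xs‖) ≤ RCLike.re (inner 𝕜 u (x - xs)) :=
      (abs_le.1 ((RCLike.abs_re_le_norm _).trans (norm_inner_le_norm u (x - xs)))).1
    have h3 : ‖x - xs‖ ≤ ‖x - z‖ + ‖z - xs‖ := norm_sub_le_norm_sub_add_norm_sub x z xs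
    have h4 : (m * ‖x - z‖) ^ 2 ≤ ‖A (x - z)‖ ^ 2 := by gcongr; exact hA _
    have h5 : ‖u‖ * ‖x - xs‖ ≤ ‖u‖ * (‖x - z‖ + ‖z - xs‖) := by gcongr
    have h6 : ‖u‖ ^ 2 / (2 * m ^ 2) - ‖u‖ * ‖x - z‖ + 1 / 2 * (m * ‖x - z‖) ^ 2
        = 1 / 2 * (‖u‖ / m - m * ‖x - z‖) ^ 2 := by field_simp; ring
    have h7 := sq_nonneg (‖u‖ / m - m * ‖x - z‖)
    simp only [hψ]
    linarith
  set M := sInf (ψ '' D) with hM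
  have hMle : ∀ y ∈ D, M ≤ ψ y := fun y hy => csInf_le hbdd ⟨y, hy, rfl⟩
  have hex : ∀ n : ℕ, ∃ x ∈ D, ψ x < M + 1 / ((n : ℝ) + 1) := by
    intro n
    obtain ⟨_, ⟨x, hx, rfl⟩, h⟩ := exists_lt_of_csInf_lt (s := ψ '' D) ⟨_, xs, hxs, rfl⟩
      (show sInf (ψ '' D) < M + 1 / ((n : ℝ) + 1) from lt_add_of_pos_right _ (by positivity))
    exact ⟨x, hx, h⟩
  choose x hxD hxlt using hex
  have hψx : Tendsto (fun n => ψ (x n)) atTop (𝓝 M) := by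
    refine tendsto_of_tendsto_of_tendsto_of_le_of_le tendsto_const_nhds
      (h := fun n : ℕ => M + 1 / ((n : ℝ) + 1)) ?_ (fun n => hMle _ (hxD n)) (fun n => (hxlt n).le)
    simpa using tendsto_const_nhds.add (tendsto_one_div_add_atTop_nhds_zero_nat (𝕜 := ℝ))
  have hcauchy : CauchySeq x := by
    -- At the midpoint the convexity gain is `‖A (x n - x k)‖² / 8`, which cannot exceed the excess
    -- `1 / (N + 1)` over the infimum.
    refine cauchySeq_of_le_tendsto_0 (fun N : ℕ => √(8 / m ^ 2 * (1 / ((N : ℝ) + 1)))) ?_ ?_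
    · intro n k N hn hk
      rw [dist_eq_norm]
      apply Real.le_sqrt_of_sq_le
      obtain ⟨h1, h2⟩ := hconv _ (hxD n) _ (hxD k) (1 / 2) (1 / 2) (by norm_num) (by norm_num)
        (by norm_num)
      have h3 := hMle _ h1
      have h4 := hxlt n
      have h5 := hxlt k
      have h6 : 1 / ((n : ℝ) + 1) ≤ 1 / ((N : ℝ) + 1) := by gcongr
      have h7 : 1 / ((k : ℝ) + 1) ≤ 1 / ((N : ℝ) + 1) := by gcongr
      have h8 : (m * ‖x n - x k‖) ^ 2 ≤ ‖A (x n - x k)‖ ^ 2 := by gcongr; exact hA _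
      have h9 : (m * ‖x n - x k‖) ^ 2 ≤ 8 * (1 / ((N : ℝ) + 1)) := by linarith
      rw [div_mul_eq_mul_div, le_div_iff₀ (by positivity)]
      linarith
    · have := (tendsto_one_div_add_atTop_nhds_zero_nat (𝕜 := ℝ)).const_mul (8 / m ^ 2)
      rw [mul_zero] at this
      simpa [Function.comp_def] using (Real.continuous_sqrt.tendsto 0).comp this
  obtain ⟨p, hp⟩ := cauchySeq_tendsto_of_complete hcauchy
  -- Apply strong convexity to `a • x n + (1 - a) • y`, let `n → ∞`, divide by `1 - a`, then let `a
  -- → 1`. Only values along the sequence enter, never `j p`.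
  have hstrong : ∀ y ∈ D, M + 1 / 2 * ‖A (p - y)‖ ^ 2 ≤ ψ y := by
    intro y hy
    have hAp : Tendsto (fun n => ‖A (x n - y)‖ ^ 2) atTop (𝓝 (‖A (p - y)‖ ^ 2)) :=
      ((A.continuous.tendsto _).comp (hp.sub_const y)).norm.pow 2
    have key : ∀ a ∈ Ioo (0 : ℝ) 1, M + 1 / 2 * (a * ‖A (p - y)‖ ^ 2) ≤ ψ y := by
      intro a ha
      have hb : 0 < 1 - a := by linarith [ha.2]
      have h1 : M ≤ a * M + (1 - a) * ψ y - 1 / 2 * (a * (1 - a) * ‖A (p - y)‖ ^ 2) := by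
        refine ge_of_tendsto (((hψx.const_mul a).add_const _).sub
          ((hAp.const_mul (a * (1 - a))).const_mul (1 / 2))) (Eventually.of_forall fun n => ?_)
        obtain ⟨h1, h2⟩ := hconv _ (hxD n) _ hy a (1 - a) ha.1.le hb.le (by ring)
        exact (hMle _ h1).trans h2
      have h2 : (1 - a) * (M + 1 / 2 * (a * ‖A (p - y)‖ ^ 2)) ≤ (1 - a) * ψ y := by linarith
      exact le_of_mul_le_mul_left h2 hb
    have hlim : Tendsto (fun a : ℝ => M + 1 / 2 * (a * ‖A (p - y)‖ ^ 2)) (𝓝[<] 1)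
        (𝓝 (M + 1 / 2 * (1 * ‖A (p - y)‖ ^ 2))) :=
      (Continuous.tendsto (by fun_prop) 1).mono_left nhdsWithin_le_nhds
    rw [one_mul] at hlim
    exact le_of_tendsto hlim (by
      filter_upwards [Ioo_mem_nhdsLT (zero_lt_one' ℝ)] with a ha using key a ha)
  have hjx : Tendsto (fun n => j (x n)) atTop (𝓝 (M - 1 / 2 * ‖A (p - z)‖ ^ 2)) := by
    have hAp : Tendsto (fun n => ‖A (x n - z)‖ ^ 2) atTop (𝓝 (‖A (p - z)‖ ^ 2)) :=
      ((A.continuous.tendsto _).comp (hp.sub_const z)).norm.pow 2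
    have := hψx.sub (hAp.const_mul (1 / 2))
    simpa [hψ] using this
  have hvar : RCLike.re (inner 𝕜 u (p - xs)) +
      RCLike.re (inner 𝕜 (A (p - z)) (A (p - xs))) ≤ 0 := by
    have h1 := hstrong xs hxs
    have h2 : j xs + RCLike.re (inner 𝕜 u (p - xs)) ≤ M - 1 / 2 * ‖A (p - z)‖ ^ 2 := by
      refine le_of_tendsto_of_tendsto' ?_ hjx fun n => hu _ (hxD n)
      refine tendsto_const_nhds.add (Continuous.tendsto' (f := fun y : X =>
        RCLike.re (inner 𝕜 u (y - xs))) ?_ p _ rfl |>.comp hp)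
      exact RCLike.continuous_re.comp (continuous_const.inner (continuous_id.sub continuous_const))
    have e : xs - z = (p - z) - (p - xs) := by abel
    have h3 : ψ xs = j xs + 1 / 2 * (‖A (p - z)‖ ^ 2
        - 2 * RCLike.re (inner 𝕜 (A (p - z)) (A (p - xs))) + ‖A (p - xs)‖ ^ 2) := by
      rw [← norm_sub_sq, ← map_sub, ← e]
    linarith
  -- First use of semicontinuity, at a point already known to satisfy the variational inequality.
  obtain ⟨hpD, hpl⟩ := hlsc p hvar x _ hxD hp hjx
  exact ⟨p, hpD, hvar, fun y hy => by have := hstrong y hy; simp only [hψ] at this; linarith⟩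

end

/-! ### Proximal points and their distance from the solution -/

section
variable {𝕜 : Type*} [RCLike 𝕜]
  {X : Type*} [NormedAddCommGroup X] [InnerProductSpace 𝕜 X] [CompleteSpace X]
  {Y : Type*} [NormedAddCommGroup Y] [InnerProductSpace 𝕜 Y] [CompleteSpace Y]

omit [CompleteSpace X] in
theorem ne_top_of_mem_subdifferential {J : X → EReal} (hJ : IsProper J) {x u : X}
    (hu : u ∈ subdifferential 𝕜 J x) : J x ≠ ⊤ := by
  obtain ⟨y, hy⟩ := hJ.2
  intro h
  have := hu y
  rw [h, EReal.top_add_coe, top_le_iff] at this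
  exact hy this

omit [CompleteSpace X] in
theorem le_of_lowerSemicontinuousAt_of_tendsto {J : X → EReal} {p : X}
    (hJ : LowerSemicontinuousAt J p) {x : ℕ → X} {l : EReal} (hx : Tendsto x atTop (𝓝 p))
    (hl : Tendsto (fun n => J (x n)) atTop (𝓝 l)) : J p ≤ l := by
  refine le_of_forall_lt fun y hy => ?_
  obtain ⟨y', h1, h2⟩ := exists_between hy
  exact h1.trans_le (ge_of_tendsto hl ((hx.eventually (hJ y' h2)).mono fun n h => h.le))

/-- The proximal point exists and is unique, provided `J` is lower semicontinuous at all points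
that satisfy the variational inequality at a point `xs` with subgradient `u`. -/
theorem existsUnique_isProxPoint {J : X → EReal} (hJ : IsProper J) (hJc : IsConvex 𝕜 J)
    {A : X →L[𝕜] Y} {m : ℝ} (hm : 0 < m) (hA : ∀ v, m * ‖v‖ ≤ ‖A v‖) {xs u z : X}
    (hu : u ∈ subdifferential 𝕜 J xs)
    (hlsc : ∀ p : X, RCLike.re (inner 𝕜 u (p - xs)) +
      RCLike.re (inner 𝕜 (A (p - z)) (A (p - xs))) ≤ 0 → LowerSemicontinuousAt J p) :
    ∃ p, RCLike.re (inner 𝕜 u (p - xs)) + RCLike.re (inner 𝕜 (A (p - z)) (A (p - xs))) ≤ 0 ∧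
      IsProxPoint J (ContinuousLinearMap.adjoint A ∘L A) z p ∧
      ∀ q, IsProxPoint J (ContinuousLinearMap.adjoint A ∘L A) z q → q = p := by
  have hcoe : ∀ x ∈ {x | J x ≠ ⊤}, J x = ((J x).toReal : EReal) := fun x hx =>
    (EReal.coe_toReal hx (hJ.1 x)).symm
  have hconv : ∀ x ∈ {x | J x ≠ ⊤}, ∀ y ∈ {x | J x ≠ ⊤}, ∀ a b : ℝ, 0 ≤ a → 0 ≤ b → a + b = 1 →
      (a : 𝕜) • x + (b : 𝕜) • y ∈ {x | J x ≠ ⊤} ∧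
        (J ((a : 𝕜) • x + (b : 𝕜) • y)).toReal ≤ a * (J x).toReal + b * (J y).toReal := by
    intro x hx y hy a b ha hb hab
    have h := hJc x y a b ha hb hab
    rw [hcoe x hx, hcoe y hy] at h
    norm_cast at h
    have hD : J ((a : 𝕜) • x + (b : 𝕜) • y) ≠ ⊤ := fun h' => by
      rw [h', top_le_iff] at h
      exact EReal.coe_ne_top _ h
    refine ⟨hD, ?_⟩
    rw [hcoe _ hD] at h
    exact_mod_cast h
  have hsub : ∀ y ∈ {x | J x ≠ ⊤},
      (J xs).toReal + RCLike.re (inner 𝕜 u (y - xs)) ≤ (J y).toReal := by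
    intro y hy
    have h := hu y
    rw [hcoe y hy, hcoe xs (ne_top_of_mem_subdifferential hJ hu)] at h
    exact_mod_cast h
  have hlim : ∀ p : X, RCLike.re (inner 𝕜 u (p - xs)) +
      RCLike.re (inner 𝕜 (A (p - z)) (A (p - xs))) ≤ 0 → ∀ (x : ℕ → X) (l : ℝ),
      (∀ n, x n ∈ {x | J x ≠ ⊤}) → Tendsto x atTop (𝓝 p) →
      Tendsto (fun n => (J (x n)).toReal) atTop (𝓝 l) →
      p ∈ {x | J x ≠ ⊤} ∧ (J p).toReal ≤ l := by
    intro p hp x l hxD hx hl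
    have h : J p ≤ (l : EReal) := by
      refine le_of_lowerSemicontinuousAt_of_tendsto (hlsc p hp) hx ?_
      exact ((continuous_coe_real_ereal.tendsto l).comp hl).congr fun n => (hcoe _ (hxD n)).symm
    have hD : J p ≠ ⊤ := fun h' => by
      rw [h', top_le_iff] at h
      exact EReal.coe_ne_top _ h
    refine ⟨hD, ?_⟩
    rw [hcoe _ hD] at h
    exact_mod_cast h
  obtain ⟨p, hpD, hvar, hmin⟩ := exists_strong_minimizer (j := fun x => (J x).toReal) (z := z)
    hconv hm hA (ne_top_of_mem_subdifferential hJ hu) hsub hlim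
  refine ⟨p, hvar, fun x => ?_, fun q hq => ?_⟩
  · rw [normSqH_adjoint_comp_self, normSqH_adjoint_comp_self]
    by_cases hx : J x = ⊤
    · rw [hx, EReal.top_add_coe]; exact le_top
    · rw [hcoe p hpD, hcoe x hx]
      norm_cast
      have := hmin x hx
      have := sq_nonneg ‖A (p - x)‖
      linarith
  · have h := hq p
    rw [normSqH_adjoint_comp_self, normSqH_adjoint_comp_self, hcoe p hpD] at h
    have hqD : J q ≠ ⊤ := by
      intro hq'
      rw [hq', EReal.top_add_coe, top_le_iff, ← EReal.coe_add] at h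
      exact EReal.coe_ne_top _ h
    rw [hcoe q hqD] at h
    norm_cast at h
    have h1 := hmin q hqD
    have h2 : ‖A (p - q)‖ ^ 2 ≤ 0 := by linarith
    have h3 : ‖A (p - q)‖ = 0 := pow_eq_zero_iff two_ne_zero |>.1 (h2.antisymm (sq_nonneg _))
    have h4 := hA (p - q)
    rw [h3] at h4
    have h5 : ‖p - q‖ ≤ 0 := by
      by_contra! h6
      exact absurd h4 (not_le.2 (mul_pos hm h6))
    exact (sub_eq_zero.1 (norm_le_zero_iff.1 h5)).symm

/-- The distance from `xs` of a point that satisfies the variational inequality of a proximal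
Gauss-Newton step. -/
theorem norm_sub_le_of_variational_inequality {A B : X →L[𝕜] Y} {G : Y →L[𝕜] X}
    (hG : IsMoorePenroseInverse A G) {m : ℝ} (hm : 0 < m) (hA : ∀ v, m * ‖v‖ ≤ ‖A v‖)
    {x xs p : X} {y ys : Y}
    (h : RCLike.re (inner 𝕜 (-(ContinuousLinearMap.adjoint B ys)) (p - xs)) +
      RCLike.re (inner 𝕜 (A (p - (x - G y))) (A (p - xs))) ≤ 0) :
    ‖p - xs‖ ≤ ‖y - ys - A (x - xs)‖ / m + ‖ys‖ * ‖A - B‖ / m ^ 2 := by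
  -- Against the range of `A`, the normal equation replaces `A (G y)` by `y`.
  have e1 : (inner 𝕜 (A (p - (x - G y))) (A (p - xs)) : 𝕜)
      = inner 𝕜 (A (p - xs) + (y - ys - A (x - xs)) + ys) (A (p - xs)) := by
    rw [← ContinuousLinearMap.adjoint_inner_left, ← ContinuousLinearMap.adjoint_inner_left A _
      (_ + _ + _)]
    congr 1
    have : p - (x - G y) = (p - xs) - (x - xs) + G y := by abel
    rw [this, map_add, map_add, hG.adjoint_apply, ← map_add]
    congr 1
    rw [map_sub]
    abel
  rw [e1, inner_neg_left, ContinuousLinearMap.adjoint_inner_left, inner_add_left, inner_add_left,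
    map_add, map_add, map_neg, inner_self_eq_norm_sq] at h
  have e2 : RCLike.re (inner 𝕜 ys ((A - B) (p - xs)))
      = RCLike.re (inner 𝕜 ys (A (p - xs))) - RCLike.re (inner 𝕜 ys (B (p - xs))) := by
    rw [sub_apply, inner_sub_right, map_sub]
  have h1 : -(‖ys‖ * (‖A - B‖ * ‖p - xs‖)) ≤ RCLike.re (inner 𝕜 ys ((A - B) (p - xs))) := by
    refine le_trans ?_ (abs_le.1 ((RCLike.abs_re_le_norm _).trans (norm_inner_le_norm _ _))).1
    have := (A - B).le_opNorm (p - xs)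
    gcongr
  have h2 : -(‖y - ys - A (x - xs)‖ * ‖A (p - xs)‖)
      ≤ RCLike.re (inner 𝕜 (y - ys - A (x - xs)) (A (p - xs))) :=
    (abs_le.1 ((RCLike.abs_re_le_norm _).trans (norm_inner_le_norm _ _))).1
  have h3 := hA (p - xs)
  set a := ‖A (p - xs)‖
  set W := ‖y - ys - A (x - xs)‖
  set C := ‖ys‖ * ‖A - B‖ with hC
  have hC0 : 0 ≤ C := by positivity
  have h4 : ‖p - xs‖ ≤ a / m := by rw [le_div_iff₀ hm]; linarith
  have h5 : a ≤ W + C / m := by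
    rcases (norm_nonneg (A (p - xs))).eq_or_lt with ha | ha
    · change 0 = a at ha
      rw [← ha]
      positivity
    · have h6 : a ^ 2 ≤ W * a + C * ‖p - xs‖ := by rw [hC]; linarith
      have h7 : C * ‖p - xs‖ ≤ C * (a / m) := by gcongr
      refine le_of_mul_le_mul_right (a := a) ?_ ha
      calc a * a ≤ W * a + C * (a / m) := by linarith
        _ = (W + C / m) * a := by ring
  calc ‖p - xs‖ ≤ a / m := h4
    _ ≤ (W + C / m) / m := by gcongr
    _ = W / m + C / m ^ 2 := by field_simp

end

/-! ### Estimates with the majorant function -/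

section
variable {𝕜 : Type*} [RCLike 𝕜]
  {X : Type*} [NormedAddCommGroup X] [InnerProductSpace 𝕜 X]
  {Y : Type*} [NormedAddCommGroup Y] [InnerProductSpace 𝕜 Y]

/-- Secant slopes of a convex function increase: compare `[τσ, σ]` with `[τs, s]`, of lengths `(1 -
τ)σ` and `(1 - τ)s`. -/
theorem convexOn_sub_le_div_mul_sub {g : ℝ → ℝ} {R : ℝ} (hg : ConvexOn ℝ (Ico 0 R) g)
    {σ s τ : ℝ} (hσ : 0 ≤ σ) (hσs : σ ≤ s) (hs : 0 < s) (hsR : s < R) (hτ : τ ∈ Icc (0 : ℝ) 1) :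
    g σ - g (τ * σ) ≤ σ / s * (g s - g (τ * s)) := by
  rcases hσ.eq_or_lt with rfl | hσ
  · simp
  rcases hτ.2.eq_or_lt with rfl | hτ1
  · simp
  have h0 : τ * σ < σ := by nlinarith
  have h1 : τ * s < s := by nlinarith
  have h2 : τ * σ ≤ τ * s := mul_le_mul_of_nonneg_left hσs hτ.1
  have m1 : τ * σ ∈ Ico 0 R := ⟨mul_nonneg hτ.1 hσ.le, by linarith⟩
  have m2 : σ ∈ Ico 0 R := ⟨hσ.le, by linarith⟩
  have m3 : s ∈ Ico 0 R := ⟨hs.le, hsR⟩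
  have m4 : τ * s ∈ Ico 0 R := ⟨mul_nonneg hτ.1 hs.le, by linarith⟩
  have s1 := hg.secant_mono m1 m2 m3 h0.ne' (by linarith) hσs
  have s2 := hg.secant_mono m3 m1 m4 (by linarith) h1.ne h2
  rw [← neg_sub s, ← neg_sub (g s), neg_div_neg_eq, ← neg_sub s, ← neg_sub (g s),
    neg_div_neg_eq] at s2
  have s3 := s1.trans s2
  have e1 : σ - τ * σ = (1 - τ) * σ := by ring
  have e2 : s - τ * s = (1 - τ) * s := by ring
  have ht : 0 < 1 - τ := by linarith
  rw [e1, e2, div_le_div_iff₀ (by positivity) (by positivity)] at s3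
  rw [div_mul_eq_mul_div, le_div_iff₀ hs]
  refine le_of_mul_le_mul_left (a := 1 - τ) ?_ ht
  linarith

/-- Supplies the bounding function for the two mean value comparisons below; at `τ = 1` it equals `s
* f' s - f s`. -/
theorem hasDerivWithinAt_mul_sub_comp {f f' : ℝ → ℝ} {R s : ℝ}
    (hf : ∀ t ∈ Ico 0 R, HasDerivWithinAt f (f' t) (Ico 0 R) t) (hs : 0 < s) (hsR : s < R)
    {τ : ℝ} (hτ : τ ∈ Icc (0 : ℝ) 1) :
    HasDerivWithinAt (fun τ => τ * (s * f' s) - f (τ * s)) (s * (f' s - f' (τ * s)))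
      (Icc 0 1) τ := by
  have hmem : ∀ τ ∈ Icc (0 : ℝ) 1, τ * s ∈ Ico 0 R := fun τ hτ =>
    ⟨mul_nonneg hτ.1 hs.le, by nlinarith [hτ.2]⟩
  have h1 : HasDerivWithinAt (fun τ : ℝ => τ * s) s (Icc 0 1) τ := by
    simpa using (hasDerivWithinAt_id τ (Icc 0 1)).mul_const s
  have h2 := (hf _ (hmem τ hτ)).comp τ h1 hmem
  have h3 := ((hasDerivWithinAt_id τ (Icc 0 1)).mul_const (s * f' s)).sub h2
  exact h3.congr_deriv (by ring)

theorem mul_sub_nonneg_of_monotone_deriv {f f' : ℝ → ℝ} {R s : ℝ}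
    (hf : ∀ t ∈ Ico 0 R, HasDerivWithinAt f (f' t) (Ico 0 R) t)
    (hmono : MonotoneOn f' (Ico 0 R)) (h0 : f 0 = 0) (hs : 0 < s) (hsR : s < R) :
    0 ≤ s * f' s - f s := by
  have h := image_norm_le_of_norm_deriv_right_le_deriv_boundary' (a := (0 : ℝ)) (b := 1)
    (f := fun _ => (0 : ℝ)) (f' := fun _ => 0)
    (B := fun τ => τ * (s * f' s) - f (τ * s)) (B' := fun τ => s * (f' s - f' (τ * s)))
    continuousOn_const (fun _ _ => hasDerivWithinAt_const ..) (by simp [h0])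
    (fun τ hτ => (hasDerivWithinAt_mul_sub_comp hf hs hsR hτ).continuousWithinAt)
    (fun τ hτ => (hasDerivWithinAt_mul_sub_comp hf hs hsR ⟨hτ.1, hτ.2.le⟩).mono_of_mem_nhdsWithin
      (mem_of_superset (Ico_mem_nhdsGE hτ.2) (Icc_subset_Icc_left hτ.1 |>.trans' Ico_subset_Icc_self)))
    (fun τ hτ => ?_) (right_mem_Icc.2 zero_le_one)
  · simpa using h
  · have : f' (τ * s) ≤ f' s := hmono ⟨mul_nonneg hτ.1 hs.le, by nlinarith [hτ.2]⟩
      ⟨hs.le, hsR⟩ (by nlinarith [hτ.2])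
    simpa using mul_nonneg hs.le (sub_nonneg.2 this)

/-- The linearization error is bounded by that of the majorant function. -/
theorem norm_linearization_error_le {F : X → Y} {f f' : ℝ → ℝ} {R β s : ℝ} {x xs : X}
    (hβ : 0 ≤ β)
    (hF : ∀ τ ∈ Icc (0 : ℝ) 1, DifferentiableAt 𝕜 F (xs + (τ : 𝕜) • (x - xs)))
    (hf : ∀ t ∈ Ico 0 R, HasDerivWithinAt f (f' t) (Ico 0 R) t)
    (hconv : ConvexOn ℝ (Ico 0 R) f') (h0 : f 0 = 0)
    (hmaj : ∀ τ ∈ Icc (0 : ℝ) 1,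
      β * ‖fderiv 𝕜 F x - fderiv 𝕜 F (xs + (τ : 𝕜) • (x - xs))‖
        ≤ f' ‖x - xs‖ - f' (τ * ‖x - xs‖))
    (hs : 0 < s) (hsR : s < R) (hxs : ‖x - xs‖ ≤ s) :
    β * ‖F x - F xs - fderiv 𝕜 F x (x - xs)‖ ≤ (‖x - xs‖ / s) ^ 2 * (s * f' s - f s) := by
  let : NormedSpace ℝ X := NormedSpace.restrictScalars ℝ 𝕜 X
  let : NormedSpace ℝ Y := NormedSpace.restrictScalars ℝ 𝕜 Y
  have : IsScalarTower ℝ 𝕜 X := .of_algebraMap_smul fun _ _ => rfl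
  have : IsScalarTower ℝ 𝕜 Y := .of_algebraMap_smul fun _ _ => rfl
  set d := x - xs with hd
  set σ := ‖d‖
  have hγ : ∀ τ : ℝ, HasDerivAt (fun τ : ℝ => xs + (τ : 𝕜) • d) d τ := by
    intro τ
    have h1 : HasDerivAt (fun τ : ℝ => xs + τ • d) ((1 : ℝ) • d) τ :=
      ((hasDerivAt_id τ).smul_const d).const_add xs
    rw [one_smul] at h1
    simp_rw [RCLike.real_smul_eq_coe_smul (K := 𝕜)] at h1
    exact h1
  have hg : ∀ τ ∈ Icc (0 : ℝ) 1, HasDerivAt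
      (fun τ : ℝ => β • (F (xs + (τ : 𝕜) • d) - F xs - τ • fderiv 𝕜 F x d))
      (β • (fderiv 𝕜 F (xs + (τ : 𝕜) • d) d - fderiv 𝕜 F x d)) τ := by
    intro τ hτ
    have h1 := ((hF τ hτ).hasFDerivAt.restrictScalars ℝ).comp_hasDerivAt τ (hγ τ)
    have h2 : HasDerivAt (fun τ : ℝ => τ • fderiv 𝕜 F x d) ((1 : ℝ) • fderiv 𝕜 F x d) τ :=
      (hasDerivAt_id τ).smul_const _
    rw [one_smul] at h2
    exact ((h1.sub_const (F xs)).sub h2).const_smul β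
  -- Mean value comparison along the segment, with the derivative frozen at the endpoint `x`. One
  -- factor `σ / s` comes from the secant inequality, the other from `‖d‖ = σ`.
  have h := image_norm_le_of_norm_deriv_right_le_deriv_boundary' (a := (0 : ℝ)) (b := 1)
    (f := fun τ : ℝ => β • (F (xs + (τ : 𝕜) • d) - F xs - τ • fderiv 𝕜 F x d))
    (f' := fun τ => β • (fderiv 𝕜 F (xs + (τ : 𝕜) • d) d - fderiv 𝕜 F x d))
    (B := fun τ => (σ / s) ^ 2 * (τ * (s * f' s) - f (τ * s)))
    (B' := fun τ => (σ / s) ^ 2 * (s * (f' s - f' (τ * s))))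
    (fun τ hτ => (hg τ hτ).continuousAt.continuousWithinAt)
    (fun τ hτ => (hg τ ⟨hτ.1, hτ.2.le⟩).hasDerivWithinAt) (by simp [h0])
    (fun τ hτ => ((hasDerivWithinAt_mul_sub_comp hf hs hsR hτ).const_mul _).continuousWithinAt)
    (fun τ hτ => ((hasDerivWithinAt_mul_sub_comp hf hs hsR
        ⟨hτ.1, hτ.2.le⟩).mono_of_mem_nhdsWithin
      (mem_of_superset (Ico_mem_nhdsGE hτ.2)
        (Icc_subset_Icc_left hτ.1 |>.trans' Ico_subset_Icc_self))).const_mul _)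
    (fun τ hτ => ?_) (right_mem_Icc.2 zero_le_one)
  · have e : xs + ((1 : ℝ) : 𝕜) • d = x := by simp [hd]
    simp only [e, one_smul, one_mul, norm_smul, Real.norm_of_nonneg hβ] at h
    exact h
  · have hτ' : τ ∈ Icc (0 : ℝ) 1 := ⟨hτ.1, hτ.2.le⟩
    rw [norm_smul, Real.norm_of_nonneg hβ, norm_sub_rev, ← sub_apply]
    calc β * ‖(fderiv 𝕜 F x - fderiv 𝕜 F (xs + (τ : 𝕜) • d)) d‖
        ≤ β * (‖fderiv 𝕜 F x - fderiv 𝕜 F (xs + (τ : 𝕜) • d)‖ * σ) := by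
          gcongr; exact ContinuousLinearMap.le_opNorm _ _
      _ = (β * ‖fderiv 𝕜 F x - fderiv 𝕜 F (xs + (τ : 𝕜) • d)‖) * σ := by ring
      _ ≤ (f' σ - f' (τ * σ)) * σ := by gcongr; exact hmaj τ hτ'
      _ ≤ (σ / s * (f' s - f' (τ * s))) * σ := by
          gcongr
          exact convexOn_sub_le_div_mul_sub hconv (norm_nonneg d) hxs hs hsR hτ'
      _ = (σ / s) ^ 2 * (s * (f' s - f' (τ * s))) := by field_simp

/-- Slopes from `0` increase by convexity and are nonnegative by monotonicity, so they converge to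
their infimum. -/
theorem exists_hasDerivWithinAt_Ioi_zero {g : ℝ → ℝ} {R : ℝ} (hR : 0 < R)
    (hconv : ConvexOn ℝ (Ico 0 R) g) (hmono : MonotoneOn g (Ico 0 R)) :
    ∃ D, HasDerivWithinAt g D (Ioi 0) 0 := by
  have h0 : (0 : ℝ) ∈ Ico 0 R := ⟨le_rfl, hR⟩
  have hm : MonotoneOn (slope g 0) (Ioo 0 R) := fun x hx y hy hxy => by
    have := hconv.secant_mono h0 ⟨hx.1.le, hx.2⟩ ⟨hy.1.le, hy.2⟩ hx.1.ne' hy.1.ne' hxy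
    simpa [slope_def_field] using this
  have hb : BddBelow (slope g 0 '' Ioo 0 R) := by
    refine ⟨0, ?_⟩
    rintro _ ⟨x, hx, rfl⟩
    rw [slope_def_field]
    exact div_nonneg (sub_nonneg.2 (hmono h0 ⟨hx.1.le, hx.2⟩ hx.1.le)) (by linarith [hx.1])
  refine ⟨sInf (slope g 0 '' Ioo 0 R), ?_⟩
  rw [hasDerivWithinAt_iff_tendsto_slope' (by simp)]
  exact hm.tendsto_nhdsWithin_Ioo_right (nonempty_Ioo.2 hR) hb

/-- The limit at `0` of the quotient that defines the convergence radius. -/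
theorem tendsto_majorant_quotient {f f' : ℝ → ℝ} {R κ a b D : ℝ} (hR : 0 < R)
    (hf : HasDerivWithinAt f (f' 0) (Ico 0 R) 0) (hf' : ContinuousWithinAt f' (Ico 0 R) 0)
    (h0 : f 0 = 0) (h1 : f' 0 = -1) (hD : HasDerivWithinAt f' D (Ioi 0) 0) :
    Tendsto (fun t => ((f' t + 1 + κ) * (t * f' t - f t + a * (f' t + 1)) + b * (f' t + 1))
      / (t * f' t ^ 2)) (𝓝[>] 0) (𝓝 ((κ * a + b) * D)) := by
  have hle : 𝓝[>] (0 : ℝ) ≤ 𝓝[Ico 0 R] 0 := by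
    rw [← nhdsWithin_Ioo_eq_nhdsGT hR]
    exact nhdsWithin_mono _ Ioo_subset_Ico_self
  have t1 : Tendsto f' (𝓝[>] 0) (𝓝 (-1)) := by
    have := hf'.tendsto.mono_left hle
    rwa [h1] at this
  have t2 : Tendsto (fun t => f t / t) (𝓝[>] 0) (𝓝 (-1)) := by
    have h := (hf.mono Ioo_subset_Ico_self)
    rw [hasDerivWithinAt_iff_tendsto_slope' (by simp), nhdsWithin_Ioo_eq_nhdsGT hR, h1] at h
    refine h.congr fun t => ?_
    rw [slope_def_field, h0, sub_zero, sub_zero]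
  have t3 : Tendsto (fun t => (f' t + 1) / t) (𝓝[>] 0) (𝓝 D) := by
    rw [hasDerivWithinAt_iff_tendsto_slope' (by simp)] at hD
    refine hD.congr fun t => ?_
    rw [slope_def_field, h1, sub_zero, sub_neg_eq_add]
  -- Divide numerator and denominator by `t`: the linearization part `f' t - f t / t` vanishes in
  -- the limit, leaving the terms with `D`.
  have t4 := ((((t1.add_const 1).add_const κ).mul ((t1.sub t2).add (t3.const_mul a))).add
    (t3.const_mul b)).div (t1.pow 2) (by norm_num)
  have e : ((-1 + 1 + κ) * (-1 - -1 + a * D) + b * D) / (-1) ^ 2 = (κ * a + b) * D := by ring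
  rw [e] at t4
  refine t4.congr' ?_
  filter_upwards [self_mem_nhdsWithin] with t ht
  have ht : t ≠ 0 := (mem_Ioi.1 ht).ne'
  simp only [Pi.div_apply]
  field_simp

end

/-! ### One step of the iteration -/

section
variable {𝕜 : Type*} [RCLike 𝕜]
  {X : Type*} [NormedAddCommGroup X] [InnerProductSpace 𝕜 X] [CompleteSpace X]
  {Y : Type*} [NormedAddCommGroup Y] [InnerProductSpace 𝕜 Y] [CompleteSpace Y]

/-- Bound for the error after one proximal Gauss-Newton step that starts at distance `σ` from the
solution, in terms of the majorant function at a reference radius `s ≥ σ`. -/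
noncomputable def stepBound (f f' : ℝ → ℝ) (c β s σ : ℝ) : ℝ :=
  (σ / s) ^ 2 * (s * f' s - f s) / (-f' s) + c * β * (σ / s * (f' s + 1)) / f' s ^ 2

/-- Uses `-f' s ≤ 1 ≤ κ ≤ f' s + 1 + κ` and `(σ / s)² ≤ σ / s`; the factor of `σ` is the quotient
defining `ρ`. -/
theorem stepBound_le_mul {f f' : ℝ → ℝ} {c β κ s σ : ℝ} (hcβ : 0 ≤ c * β) (hκ : 1 ≤ κ)
    (hs : 0 < s) (hσ : 0 ≤ σ) (hσs : σ ≤ s) (hf's : f' s < 0) (hf's1 : 0 ≤ f' s + 1)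
    (hfs : 0 ≤ s * f' s - f s) :
    stepBound f f' c β s σ ≤
      ((f' s + 1 + κ) * (s * f' s - f s + c * β * (1 + √2) * (f' s + 1)) + c * β * (f' s + 1))
        / (s * f' s ^ 2) * σ := by
  have h2 : 0 ≤ √2 := Real.sqrt_nonneg 2
  have hn : 0 < -f' s := by linarith
  have hdiv : σ / s ≤ 1 := (div_le_one hs).2 hσs
  have hdiv0 : 0 ≤ σ / s := by positivity
  have hsq : 0 < f' s ^ 2 := by rw [← neg_sq]; positivity
  have h3 : (σ / s) ^ 2 * (s * f' s - f s) ≤ σ / s * (s * f' s - f s) := by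
    gcongr
    rw [sq]
    exact mul_le_of_le_one_right hdiv0 hdiv
  calc stepBound f f' c β s σ
      ≤ σ / s * (s * f' s - f s) / (-f' s) + c * β * (σ / s * (f' s + 1)) / f' s ^ 2 := by
        unfold stepBound
        gcongr
    _ = (-f' s * (s * f' s - f s) + c * β * (f' s + 1)) / (s * f' s ^ 2) * σ := by
        have : f' s ≠ 0 := hf's.ne
        field_simp
    _ ≤ _ := by
        gcongr ?_ / _ * _
        gcongr ?_ + _
        have : 0 ≤ c * β * (1 + √2) * (f' s + 1) := by positivity
        exact mul_le_mul (by linarith) (by linarith) hfs (by linarith)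

/-- Same slack as in `stepBound_le_mul`, but the quadratic term in `σ` is kept. -/
theorem stepBound_le_add {f f' : ℝ → ℝ} {c β κ s σ : ℝ} (hcβ : 0 ≤ c * β) (hκ : 1 ≤ κ)
    (hs : 0 < s) (hσ : 0 ≤ σ) (hf's : f' s < 0) (hf's1 : 0 ≤ f' s + 1)
    (hfs : 0 ≤ s * f' s - f s) :
    stepBound f f' c β s σ ≤
      (f' s + 1 + κ) * (f' s * s - f s) / (s * f' s) ^ 2 * σ ^ 2
        + (1 + √2) * β * c * (f' s + 1) ^ 2 / (s * f' s) ^ 2 * σ ^ 2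
        + c * β * ((1 + √2) * κ + 1) * (f' s + 1) / (s * f' s ^ 2) * σ := by
  have h2 : 0 ≤ √2 := Real.sqrt_nonneg 2
  have hsq : 0 < f' s ^ 2 := by rw [← neg_sq]; exact pow_pos (by linarith) 2
  have e1 : (σ / s) ^ 2 * (s * f' s - f s) / (-f' s)
      = -f' s * (f' s * s - f s) / (s * f' s) ^ 2 * σ ^ 2 := by
    have : f' s ≠ 0 := hf's.ne
    field_simp
  have e2 : c * β * (σ / s * (f' s + 1)) / f' s ^ 2
      = c * β * 1 * (f' s + 1) / (s * f' s ^ 2) * σ := by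
    field_simp
  have hfs' : 0 ≤ f' s * s - f s := by linarith
  have i1 : -f' s * (f' s * s - f s) / (s * f' s) ^ 2 * σ ^ 2
      ≤ (f' s + 1 + κ) * (f' s * s - f s) / (s * f' s) ^ 2 * σ ^ 2 := by
    gcongr
    linarith
  have i2 : c * β * 1 * (f' s + 1) / (s * f' s ^ 2) * σ
      ≤ c * β * ((1 + √2) * κ + 1) * (f' s + 1) / (s * f' s ^ 2) * σ := by
    gcongr
    have : 0 ≤ (1 + √2) * κ := mul_nonneg (by linarith) (by linarith)
    linarith
  have i3 : 0 ≤ (1 + √2) * β * c * (f' s + 1) ^ 2 / (s * f' s) ^ 2 * σ ^ 2 := by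
    have : (1 + √2) * β * c = c * β * (1 + √2) := by ring
    rw [this]
    positivity
  rw [stepBound, e1, e2]
  linarith

/-- One step of the proximal Gauss-Newton method. -/
theorem stepWellDefined_and_norm_prox_sub_le {Ω : Set X} (hΩ : IsOpen Ω) {J : X → EReal}
    (hJ : IsProper J) (hJc : IsConvex 𝕜 J) (hJlsc : LowerSemicontinuousOn J Ω) {F : X → Y}
    (hF : DifferentiableOn 𝕜 F Ω) {xs x : X} {R β δ : ℝ} (hβ : 0 < β)
    (hinv : ∀ v, ‖v‖ ≤ β * ‖fderiv 𝕜 F xs v‖) (hδ : Metric.ball xs δ ⊆ Ω)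
    (hstat : -(ContinuousLinearMap.adjoint (fderiv 𝕜 F xs) (F xs)) ∈ subdifferential 𝕜 J xs)
    {f f' : ℝ → ℝ} (hf : ∀ t ∈ Ico 0 R, HasDerivWithinAt f (f' t) (Ico 0 R) t)
    (hmaj : ∀ τ ∈ Icc (0 : ℝ) 1,
      β * ‖fderiv 𝕜 F x - fderiv 𝕜 F (xs + (τ : 𝕜) • (x - xs))‖
        ≤ f' ‖x - xs‖ - f' (τ * ‖x - xs‖))
    (hf0 : f 0 = 0) (hf'0 : f' 0 = -1) (hconv : ConvexOn ℝ (Ico 0 R) f')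
    (hmono : StrictMonoOn f' (Ico 0 R)) (hx : x ∈ Metric.ball xs δ)
    {t : ℝ} (ht : 0 < t) (htR : t < R) (hxt : ‖x - xs‖ ≤ t) (hf't : f' t < 0)
    (hbound : stepBound f f' ‖F xs‖ β t ‖x - xs‖ < δ) :
    StepWellDefined 𝕜 Ω F J x ∧
      ∀ s, ‖x - xs‖ ≤ s → 0 < s → s < R → f' s < 0 →
        ‖prox J (gramOp 𝕜 F x) (gnPoint 𝕜 F x) - xs‖ ≤ stepBound f f' ‖F xs‖ β s ‖x - xs‖ := by
  have hxΩ : x ∈ Ω := hδ hx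
  have hσ0 : 0 ≤ ‖x - xs‖ := norm_nonneg _
  set A := fderiv 𝕜 F x with hAdef
  set B := fderiv 𝕜 F xs with hBdef
  have hAB : β * ‖A - B‖ ≤ f' ‖x - xs‖ + 1 := by
    have := hmaj 0 ⟨le_rfl, zero_le_one⟩
    simpa [hf'0] using this
  -- Perturbation of the lower bound for `B`: `‖v‖ ≤ β‖B v‖ ≤ β‖A v‖ + (f' s + 1)‖v‖`. Monotonicity
  -- of `f'` allows any `s` beyond `‖x - xs‖`.
  have hlower : ∀ s, ‖x - xs‖ ≤ s → s < R → ∀ v, -f' s / β * ‖v‖ ≤ ‖A v‖ := by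
    intro s h1 h2 v
    have h3 : f' ‖x - xs‖ ≤ f' s :=
      hmono.monotoneOn ⟨hσ0, h1.trans_lt h2⟩ ⟨hσ0.trans h1, h2⟩ h1
    have h4 : ‖B v‖ ≤ ‖A v‖ + ‖A - B‖ * ‖v‖ := by
      have e : B v = A v - (A - B) v := by simp
      rw [e]
      exact (norm_sub_le _ _).trans (by gcongr; exact (A - B).le_opNorm v)
    have h5 : β * ‖B v‖ ≤ β * ‖A v‖ + (f' s + 1) * ‖v‖ := by
      calc β * ‖B v‖ ≤ β * (‖A v‖ + ‖A - B‖ * ‖v‖) := by gcongr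
        _ = β * ‖A v‖ + β * ‖A - B‖ * ‖v‖ := by ring
        _ ≤ β * ‖A v‖ + (f' s + 1) * ‖v‖ := by gcongr; linarith
    have h6 := hinv v
    rw [div_mul_eq_mul_div, div_le_iff₀ hβ]
    linarith
  have hmt : 0 < -f' t / β := div_pos (by linarith) hβ
  have hMP := exists_isMoorePenroseInverse hmt (hlower t hxt htR)
  have hvar : ∀ s, ‖x - xs‖ ≤ s → 0 < s → s < R → f' s < 0 → ∀ p,
      RCLike.re (inner 𝕜 (-(ContinuousLinearMap.adjoint B (F xs))) (p - xs)) +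
        RCLike.re (inner 𝕜 (A (p - gnPoint 𝕜 F x)) (A (p - xs))) ≤ 0 →
      ‖p - xs‖ ≤ stepBound f f' ‖F xs‖ β s ‖x - xs‖ := by
    intro s h1 h2 h3 h4 p hp
    refine (norm_sub_le_of_variational_inequality (pinv_spec hMP) (m := -f' s / β)
      (div_pos (by linarith) hβ) (hlower s h1 h3) hp).trans ?_
    have h5 := norm_linearization_error_le (𝕜 := 𝕜) hβ.le (fun τ hτ => ?_) hf hconv hf0 hmaj
      h2 h3 h1
    · have h6 : β * ‖A - B‖ ≤ ‖x - xs‖ / s * (f' s + 1) := by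
        have := convexOn_sub_le_div_mul_sub hconv hσ0 h1 h2 h3 (τ := 0) ⟨le_rfl, zero_le_one⟩
        rw [zero_mul, zero_mul, hf'0] at this
        linarith
      have h7 : 0 < -f' s := by linarith
      have h8 : 0 < f' s ^ 2 := by rw [← neg_sq]; positivity
      calc ‖F x - F xs - A (x - xs)‖ / (-f' s / β) + ‖F xs‖ * ‖A - B‖ / (-f' s / β) ^ 2
          = β * ‖F x - F xs - A (x - xs)‖ / (-f' s)
            + ‖F xs‖ * β * (β * ‖A - B‖) / f' s ^ 2 := by
            have : f' s ≠ 0 := h4.ne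
            field_simp
        _ ≤ stepBound f f' ‖F xs‖ β s ‖x - xs‖ := by
            unfold stepBound
            gcongr
    · refine hF.differentiableAt (hΩ.mem_nhds (hδ ?_))
      rw [mem_ball_iff_norm] at hx ⊢
      rw [add_sub_cancel_left, norm_smul, RCLike.norm_ofReal, abs_of_nonneg hτ.1]
      exact (mul_le_of_le_one_left hσ0 hτ.2).trans_lt hx
  -- Every candidate `p` lies in the `δ`-ball by `hvar` and `hbound`, hence in the open set `Ω`,
  -- where `J` is lower semicontinuous.
  obtain ⟨p, hp1, hp2, hp3⟩ := existsUnique_isProxPoint (z := gnPoint 𝕜 F x) hJ hJc hmt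
    (hlower t hxt htR) hstat fun p hp => by
      have hpΩ : p ∈ Ω := hδ (mem_ball_iff_norm.2 ((hvar t hxt ht htR hf't p hp).trans_lt hbound))
      have := hJlsc p hpΩ
      exact fun y hy => hΩ.nhdsWithin_eq hpΩ ▸ this y hy
  refine ⟨⟨hxΩ, ?_, hMP, ContinuousLinearMap.isPositive_adjoint_comp_self _, ?_,
    isUnit_adjoint_comp_self hmt (hlower t hxt htR), p, hp2, hp3⟩, fun s h1 h2 h3 h4 => ?_⟩
  · rw [injective_iff_map_eq_zero]
    intro v hv
    have h := hlower t hxt htR v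
    rw [hv, norm_zero] at h
    exact norm_le_zero_iff.1 (nonpos_of_mul_nonpos_right h hmt)
  · refine ⟨(-f' t / β) ^ 2, by positivity, fun v => ?_⟩
    rw [gramOp, normSqH_adjoint_comp_self, ← mul_pow]
    gcongr
    exact hlower t hxt htR v
  · rw [show prox J (gramOp 𝕜 F x) (gnPoint 𝕜 F x) = p from hp3 _ (prox_spec ⟨p, hp2⟩)]
    exact hvar s h1 h2 h3 h4 p hp1

end

end ProxGN

/-! ### Positive radii, contraction and convergence -/

theorem theorem3p1
    {𝕜 : Type*} [RCLike 𝕜]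
    {X : Type*} [NormedAddCommGroup X] [InnerProductSpace 𝕜 X] [CompleteSpace X]
    {Y : Type*} [NormedAddCommGroup Y] [InnerProductSpace 𝕜 Y] [CompleteSpace Y]
    (Ω : Set X) (hΩ : IsOpen Ω)
    (J : X → EReal) (hJproper : ProxGN.IsProper J) (hJconvex : ProxGN.IsConvex 𝕜 J)
    (hJlsc : LowerSemicontinuousOn J Ω)
    (F : X → Y) (hF : ContDiffOn 𝕜 1 F Ω)
    (hFclosed : ∀ x ∈ Ω, IsClosed (Set.range (fderiv 𝕜 F x)))
    (xs : X) (hxs : xs ∈ Ω) (R : ℝ) (hR : 0 < R)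
    (c β κ δ : ℝ)
    (hc : c = ‖F xs‖)
    (hβ : β = ‖ProxGN.pinv (fderiv 𝕜 F xs)‖)
    (hκ : κ = β * ‖fderiv 𝕜 F xs‖)
    (hδ : δ = sSup {t : ℝ | t ∈ Set.Ico 0 R ∧ Metric.ball xs t ⊆ Ω})
    (hstat : -(ContinuousLinearMap.adjoint (fderiv 𝕜 F xs) (F xs))
      ∈ ProxGN.subdifferential 𝕜 J xs)
    (hinj : Function.Injective (fderiv 𝕜 F xs))
    -- the majorant function `f : [0, R) → ℝ` and its derivative `f'`
    (f f' : ℝ → ℝ)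
    (hf : ∀ t ∈ Set.Ico 0 R, HasDerivWithinAt f (f' t) (Set.Ico 0 R) t)
    (hf' : ContinuousOn f' (Set.Ico 0 R))
    (hmaj : ∀ x ∈ Metric.ball xs δ, ∀ τ ∈ Set.Icc (0 : ℝ) 1,
      β * ‖fderiv 𝕜 F x - fderiv 𝕜 F (xs + (τ : 𝕜) • (x - xs))‖
        ≤ f' ‖x - xs‖ - f' (τ * ‖x - xs‖))
    (h1 : f 0 = 0 ∧ f' 0 = -1)
    (h2 : ConvexOn ℝ (Set.Ico 0 R) f' ∧ StrictMonoOn f' (Set.Ico 0 R))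
    -- `derivWithin f' (Set.Ioi 0) 0` is the right derivative of `f'` at `0`
    (h3 : ((1 + √2) * κ + 1) * c * β * derivWithin f' (Set.Ioi 0) 0 < 1)
    (ν ρ r : ℝ)
    (hν : ν = sSup {t : ℝ | t ∈ Set.Ico 0 R ∧ f' t < 0})
    (hρ : ρ = sSup {t : ℝ | t ∈ Set.Ioo 0 ν ∧
      ((f' t + 1 + κ) * (t * f' t - f t + c * β * (1 + √2) * (f' t + 1))
        + c * β * (f' t + 1)) / (t * f' t ^ 2) < 1})
    (hr : r = min ρ δ) :
    0 < δ ∧ 0 < ν ∧ 0 < ρ ∧ 0 < r ∧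
    ∀ x₀ ∈ Metric.ball xs r \ {xs},
      (∀ k : ℕ, ProxGN.StepWellDefined 𝕜 Ω F J (ProxGN.proxGNSeq 𝕜 F J x₀ k)) ∧
      (∀ k : ℕ, ProxGN.proxGNSeq 𝕜 F J x₀ k ∈ Metric.ball xs r) ∧
      Tendsto (ProxGN.proxGNSeq 𝕜 F J x₀) atTop (𝓝 xs) ∧
      ∀ k : ℕ,
        ‖ProxGN.proxGNSeq 𝕜 F J x₀ (k + 1) - xs‖ ≤
          (f' ‖x₀ - xs‖ + 1 + κ) * (f' ‖x₀ - xs‖ * ‖x₀ - xs‖ - f ‖x₀ - xs‖)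
              / (‖x₀ - xs‖ * f' ‖x₀ - xs‖) ^ 2 * ‖ProxGN.proxGNSeq 𝕜 F J x₀ k - xs‖ ^ 2
            + (1 + √2) * β * c * (f' ‖x₀ - xs‖ + 1) ^ 2
              / (‖x₀ - xs‖ * f' ‖x₀ - xs‖) ^ 2 * ‖ProxGN.proxGNSeq 𝕜 F J x₀ k - xs‖ ^ 2
            + c * β * ((1 + √2) * κ + 1) * (f' ‖x₀ - xs‖ + 1)
              / (‖x₀ - xs‖ * f' ‖x₀ - xs‖ ^ 2) * ‖ProxGN.proxGNSeq 𝕜 F J x₀ k - xs‖ := by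

  obtain ⟨hf0, hf'0⟩ := h1
  obtain ⟨hconv, hmono⟩ := h2
  have h0R : (0 : ℝ) ∈ Ico 0 R := ⟨le_rfl, hR⟩
  have hδbdd : BddAbove {t : ℝ | t ∈ Ico 0 R ∧ Metric.ball xs t ⊆ Ω} := ⟨R, fun t ht => ht.1.2.le⟩
  have hδpos : 0 < δ := by
    obtain ⟨ε, hε, hball⟩ := Metric.isOpen_iff.1 hΩ xs hxs
    have hmem : min ε (R / 2) ∈ {t : ℝ | t ∈ Ico 0 R ∧ Metric.ball xs t ⊆ Ω} :=
      ⟨⟨by positivity, (min_le_right _ _).trans_lt (by linarith)⟩,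
        (Metric.ball_subset_ball (min_le_left _ _)).trans hball⟩
    exact (by positivity : 0 < min ε (R / 2)).trans_le (hδ ▸ le_csSup hδbdd hmem)
  have hδball : Metric.ball xs δ ⊆ Ω := by
    intro x hx
    rw [Metric.mem_ball, hδ] at hx
    obtain ⟨t, ht, hxt⟩ := exists_lt_of_lt_csSup
      (show {t : ℝ | t ∈ Ico 0 R ∧ Metric.ball xs t ⊆ Ω}.Nonempty from ⟨0, h0R, by simp⟩) hx
    exact ht.2 hxt
  have hνbdd : BddAbove {t : ℝ | t ∈ Ico 0 R ∧ f' t < 0} := ⟨R, fun t ht => ht.1.2.le⟩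
  have hle : 𝓝[>] (0 : ℝ) ≤ 𝓝[Ico 0 R] 0 := by
    rw [← nhdsWithin_Ioo_eq_nhdsGT hR]
    exact nhdsWithin_mono _ Ioo_subset_Ico_self
  have hνpos : 0 < ν := by
    have h : ∀ᶠ t in 𝓝[>] (0 : ℝ), f' t < 0 :=
      ((hf' 0 h0R).tendsto.mono_left hle).eventually_lt_const (by rw [hf'0]; norm_num)
    obtain ⟨t, h1, h2⟩ := (h.and (Ioo_mem_nhdsGT hR)).exists
    rw [hν]
    exact h2.1.trans_le (le_csSup hνbdd ⟨⟨h2.1.le, h2.2⟩, h1⟩)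
  have hνlt : ∀ t, 0 ≤ t → t < ν → t < R ∧ f' t < 0 := by
    intro t h0 ht
    rw [hν] at ht
    obtain ⟨t', ht', htt'⟩ := exists_lt_of_lt_csSup
      (show {t : ℝ | t ∈ Ico 0 R ∧ f' t < 0}.Nonempty from ⟨0, h0R, by rw [hf'0]; norm_num⟩) ht
    have hR' : t < R := htt'.trans ht'.1.2
    exact ⟨hR', (hmono ⟨h0, hR'⟩ ht'.1 htt').trans ht'.2⟩
  set S := {t : ℝ | t ∈ Ioo 0 ν ∧
      ((f' t + 1 + κ) * (t * f' t - f t + c * β * (1 + √2) * (f' t + 1))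
        + c * β * (f' t + 1)) / (t * f' t ^ 2) < 1} with hS
  -- The quotient tends to the left side of `h3` as `t → 0+`, so it is below 1 for small `t`.
  have hSne : ∃ t, t ∈ S := by
    obtain ⟨D, hD⟩ := ProxGN.exists_hasDerivWithinAt_Ioi_zero hR hconv hmono.monotoneOn
    rw [hD.derivWithin (uniqueDiffWithinAt_Ioi 0)] at h3
    have h := (ProxGN.tendsto_majorant_quotient (κ := κ) (a := c * β * (1 + √2)) (b := c * β) hR
      (hf 0 h0R) (hf' 0 h0R) hf0 hf'0 hD).eventually_lt_const
      (show (κ * (c * β * (1 + √2)) + c * β) * D < 1 by linarith)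
    obtain ⟨t, h1, h2⟩ := (h.and (Ioo_mem_nhdsGT hνpos)).exists
    exact ⟨t, h2, h1⟩
  have hρpos : 0 < ρ := by
    obtain ⟨t, ht⟩ := hSne
    rw [hρ]
    exact ht.1.1.trans_le (le_csSup ⟨ν, fun t ht => ht.1.2.le⟩ ht)
  have hrpos : 0 < r := hr ▸ lt_min hρpos hδpos
  refine ⟨hδpos, hνpos, hρpos, hrpos, ?_⟩
  rintro x₀ ⟨hx₀, hne⟩
  rw [mem_ball_iff_norm] at hx₀
  set σ₀ := ‖x₀ - xs‖ with hσ₀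
  have hσ₀pos : 0 < σ₀ := norm_sub_pos_iff.2 hne
  -- Some `t > σ₀` has quotient below 1. Fixing it as reference radius avoids any monotonicity of
  -- the quotient.
  obtain ⟨t, ⟨⟨ht0, htν⟩, htS⟩, hσt⟩ := exists_lt_of_lt_csSup hSne
    (hρ ▸ hx₀.trans_le (hr ▸ min_le_left _ _))
  have hrδ : r ≤ δ := hr ▸ min_le_right _ _
  obtain ⟨htR, hf't⟩ := hνlt t ht0.le htν
  obtain ⟨hσR, hf'σ⟩ := hνlt σ₀ hσ₀pos.le (hσt.trans htν)
  have hpinv : ∀ v, ‖v‖ ≤ β * ‖fderiv 𝕜 F xs v‖ := by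
    obtain ⟨m, hm, hbd⟩ := ProxGN.exists_bound_of_injective_of_isClosed_range hinj (hFclosed xs hxs)
    have hMP := ProxGN.pinv_spec (ProxGN.exists_isMoorePenroseInverse hm hbd)
    intro v
    rw [hβ]
    conv_lhs => rw [← hMP.leftInverse hinj v]
    exact ContinuousLinearMap.le_opNorm _ _
  have hβpos : 0 < β := by
    by_contra! h
    have := hpinv (x₀ - xs)
    have := mul_nonpos_of_nonpos_of_nonneg h (norm_nonneg (fderiv 𝕜 F xs (x₀ - xs)))
    linarith
  -- The point `x₀ ≠ xs` supplies the nonzero vector needed here and for `β > 0`.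
  have hκ1 : 1 ≤ κ := by
    have h := (hpinv (x₀ - xs)).trans
      (mul_le_mul_of_nonneg_left (ContinuousLinearMap.le_opNorm _ _) hβpos.le)
    rw [← mul_assoc, ← hκ] at h
    exact le_of_mul_le_mul_right (by linarith) hσ₀pos
  have hcβ : 0 ≤ c * β := mul_nonneg (hc ▸ norm_nonneg _) hβpos.le
  have hf'1 : ∀ s, 0 < s → s < R → 0 ≤ f' s + 1 := fun s h0 h1 => by
    have := hmono h0R ⟨h0.le, h1⟩ h0
    linarith
  have hfnn : ∀ s, 0 < s → s < R → 0 ≤ s * f' s - f s := fun s =>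
    ProxGN.mul_sub_nonneg_of_monotone_deriv hf hmono.monotoneOn hf0
  set q := ((f' t + 1 + κ) * (t * f' t - f t + c * β * (1 + √2) * (f' t + 1))
        + c * β * (f' t + 1)) / (t * f' t ^ 2) with hq
  have hq0 : 0 ≤ q := by
    have i1 := hf'1 t ht0 htR
    have i2 := hfnn t ht0 htR
    positivity
  have hstepq : ∀ σ, 0 ≤ σ → σ ≤ σ₀ → ProxGN.stepBound f f' ‖F xs‖ β t σ ≤ q * σ := by
    intro σ h1 h2
    rw [← hc]
    exact ProxGN.stepBound_le_mul hcβ hκ1 ht0 h1 (h2.trans hσt.le) hf't (hf'1 t ht0 htR)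
      (hfnn t ht0 htR)
  have hstep : ∀ x, ‖x - xs‖ ≤ σ₀ → ProxGN.StepWellDefined 𝕜 Ω F J x ∧
      ∀ s, ‖x - xs‖ ≤ s → 0 < s → s < R → f' s < 0 →
        ‖ProxGN.prox J (ProxGN.gramOp 𝕜 F x) (ProxGN.gnPoint 𝕜 F x) - xs‖
          ≤ ProxGN.stepBound f f' ‖F xs‖ β s ‖x - xs‖ := by
    intro x hx
    have hxδ : x ∈ Metric.ball xs δ := mem_ball_iff_norm.2 ((hx.trans_lt hx₀).trans_le hrδ)
    refine ProxGN.stepWellDefined_and_norm_prox_sub_le hΩ hJproper hJconvex hJlsc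
      (hF.differentiableOn one_ne_zero) hβpos hpinv hδball hstat hf (hmaj x hxδ) hf0 hf'0 hconv
      hmono hxδ ht0 htR (hx.trans hσt.le) hf't ?_
    calc _ ≤ q * ‖x - xs‖ := hstepq _ (norm_nonneg _) hx
      _ ≤ ‖x - xs‖ := mul_le_of_le_one_left (norm_nonneg _) htS.le
      _ < δ := (hx.trans_lt hx₀).trans_le hrδ
  have hdecay : ∀ k, ‖ProxGN.proxGNSeq 𝕜 F J x₀ k - xs‖ ≤ q ^ k * σ₀ := by
    intro k
    induction k with
    | zero => simp [ProxGN.proxGNSeq, hσ₀]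
    | succ k ih =>
      have hk : ‖ProxGN.proxGNSeq 𝕜 F J x₀ k - xs‖ ≤ σ₀ :=
        ih.trans (mul_le_of_le_one_left hσ₀pos.le (pow_le_one₀ hq0 htS.le))
      calc _ ≤ _ := (hstep _ hk).2 t (hk.trans hσt.le) ht0 htR hf't
        _ ≤ q * ‖ProxGN.proxGNSeq 𝕜 F J x₀ k - xs‖ := hstepq _ (norm_nonneg _) hk
        _ ≤ q * (q ^ k * σ₀) := by gcongr
        _ = q ^ (k + 1) * σ₀ := by ring
  have hle₀ : ∀ k, ‖ProxGN.proxGNSeq 𝕜 F J x₀ k - xs‖ ≤ σ₀ := fun k =>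
    (hdecay k).trans (mul_le_of_le_one_left hσ₀pos.le (pow_le_one₀ hq0 htS.le))
  refine ⟨fun k => (hstep _ (hle₀ k)).1, fun k => mem_ball_iff_norm.2 ((hle₀ k).trans_lt hx₀),
    ?_, fun k => ?_⟩
  · rw [tendsto_iff_norm_sub_tendsto_zero]
    refine squeeze_zero (fun _ => norm_nonneg _) hdecay ?_
    simpa using (tendsto_pow_atTop_nhds_zero_of_lt_one hq0 htS).mul_const σ₀
  -- The reference radius is now `σ₀` instead of `t`; `hle₀` makes it admissible for every iterate.
  · refine ((hstep _ (hle₀ k)).2 σ₀ (hle₀ k) hσ₀pos hσR hf'σ).trans ?_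
    rw [← hc]
    exact ProxGN.stepBound_le_add hcβ hκ1 hσ₀pos (norm_nonneg _) hf'σ (hf'1 _ hσ₀pos hσR)
      (hfnn _ hσ₀pos hσR)
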